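/- Let $f_1,\dots,f_n\in\mathbb{C}(a_1,\dots,a_m)[z_1,\dots,z_n]$, let $\mathcal I=\langle f_1,\dots,f_n\rangle$, and use the lexicographic order with $z_1\succ\dots\succ z_n$. Let $\mathcal G$ be a Gröbner basis of $\mathcal I$ and assume that its standard basis (the set of monomials divisible by no leading monomial of $\mathcal G$) is finite, $\mathcal B=\{e_1,\dots,e_d\}$. Let $T_i\in\mathrm{Mat}_d(\mathbb{C}(a_1,\dots,a_m))$ be the companion matrices of $\mathcal I$, i.e. $\overline{z_ie_\alpha}^{\mathcal G}=\sum_\beta (T_i)_{\alpha\beta}e_\beta$, where the bar denotes the remainder on division. Let $\bm a\in\mathbb{C}^m$ be a point at which all coefficients of the $f_\ell$ are analytic and for which $\mathcal I(\bm a)=\langle f_1(\bullet;\bm a),\dots,f_n(\bullet;\bm a)\rangle\subseteq\mathbb{C}[z_1,\dots,z_n]$ is radical and has finitely many complex zeros; assume that the entries of $T_1,\dots,T_n$ are analytic at $\bm a$. Fix $j\in\{1,\dots,m\}$, adjoin formal variables $\partial z_i/\partial a_j$, and set $S_j=\mathbb{C}[\partial z_1/\partial a_j,\dots,\partial z_n/\partial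 a_j,z_1,\dots,z_n]$. For a polynomial $p$ in $z$ with constant coefficients put $\frac{\partial p}{\partial a_j}=\sum_i\frac{\partial p}{\partial z_i}\frac{\partial z_i}{\partial a_j}\in S_j$. Let $\mathcal I_j(\bm a)\subseteq S_j$ be the ideal generated by $\mathcal I(\bm a)$ and by the polynomials $$\frac{df_\ell}{da_j}(\bullet;\bm a)=\Big(\frac{\partial f_\ell}{\partial a_j}+\sum_i\frac{\partial f_\ell}{\partial z_i}\frac{\partial z_i}{\partial a_j}\Big)(\bullet;\bm a),\qquad \ell=1,\dots,n.$$ Let $\mathcal G(\bm a)$ and $\mathcal G_j(\bm a)$ be Gröbner bases of $\mathcal I(\bm a)$ and $\mathcal I_j(\bm a)$ for the lexicographic order with $\partial z_1/\partial a_j\succ\dots\succ\partial z_n/\partial a_j\succ z_1\succ\dots\succ z_n$, and assume that their standard bases coincide, $\mathcal B_j(\bm a)=\mathcal B(\bm a)$. Then $\mathcal B(\bm a)=\mathcal B$, and the values $T_i(\bm a)$ are the companion matrices of $\mathcal I(\bm a)$ in the basis $e_1,\dots,e_d$. Moreover, for all $i\in\{1,\dots,n\}$ and $\alpha\in\{1,\dots,d\}$,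 $$\overline{z_ie_\alpha}^{\mathcal G_j(\bm a)}=\sum_\beta T_i(\bm a)_{\alpha\beta}\,e_\beta,\qquad \overline{\frac{\partial(z_ie_\alpha)}{\partial a_j}-\sum_\beta T_i(\bm a)_{\alpha\beta}\frac{\partial e_\beta}{\partial a_j}}^{\;\mathcal G_j(\bm a)}=\sum_\beta\frac{\partial (T_i)_{\alpha\beta}}{\partial a_j}(\bm a)\,e_\beta .$$ -/

import Mathlib

open MvPolynomial MonomialOrder

noncomputable section

namespace CompanionDeriv

/-! ### Gröbner bases, division and standard monomials -/

section Groebner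

variable {σ k : Type*} [Field k]

/-- `G` is a Gröbner basis of the ideal `I` with respect to the monomial order `ord`:
a finite generating set of `I` such that the leading monomial of every non-zero element of `I`
is divisible by the leading monomial of some non-zero element of `G`. -/
def IsGroebnerBasis (ord : MonomialOrder σ) (G : Finset (MvPolynomial σ k))
    (I : Ideal (MvPolynomial σ k)) : Prop :=
  Ideal.span (G : Set (MvPolynomial σ k)) = I ∧
    ∀ f ∈ I, f ≠ 0 → ∃ g ∈ G, g ≠ 0 ∧ ord.degree g ≤ ord.degree f

/-- The exponents of the monomials that are divisible by no leading monomial of an element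
of `G`. -/
def standardMonomials (ord : MonomialOrder σ) (G : Finset (MvPolynomial σ k)) :
    Set (σ →₀ ℕ) :=
  {s | ∀ g ∈ G, g ≠ 0 → ¬ ord.degree g ≤ s}

/-- `r` is a remainder of `f` on division by `G`: `f = ∑ g ∈ G, q g * g + r`, no summand `q g * g`
has a leading monomial above that of `f`, and all monomials of `r` are standard. -/
def IsRemainder (ord : MonomialOrder σ) (G : Finset (MvPolynomial σ k))
    (f r : MvPolynomial σ k) : Prop :=
  ∃ q : MvPolynomial σ k → MvPolynomial σ k,
    f = ∑ g ∈ G, q g * g + r ∧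
    (∀ g ∈ G, ord.degree (q g * g) ≼[ord] ord.degree f) ∧
    ∀ s ∈ r.support, s ∈ standardMonomials ord G

/-- The division algorithm: a remainder exists. -/
theorem exists_isRemainder (ord : MonomialOrder σ) (G : Finset (MvPolynomial σ k))
    (f : MvPolynomial σ k) : ∃ r, IsRemainder ord G f r := by
  classical
  obtain ⟨q, r, h1, h2, h3⟩ := ord.div_set (B := {g | g ∈ G ∧ g ≠ 0})
    (fun b hb => isUnit_iff_ne_zero.mpr (ord.leadingCoeff_ne_zero_iff.mpr hb.2)) f
  refine ⟨r, fun g => if h : g ∈ G ∧ g ≠ 0 then q ⟨g, h⟩ else 0, ?_, ?_, ?_⟩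
  · rw [h1]
    congr 1
    rw [Finsupp.linearCombination_apply, Finsupp.sum]
    simp only [smul_eq_mul]
    have hs : ∀ x : {g | g ∈ G ∧ g ≠ 0}, q x * (x : MvPolynomial σ k) =
        (fun g => (if h : g ∈ G ∧ g ≠ 0 then q ⟨g, h⟩ else 0) * g) x := by
      rintro ⟨x, hx⟩
      have hx' : x ∈ G ∧ x ≠ 0 := hx
      simp only [dif_pos hx']
    rw [Finset.sum_congr rfl (fun x _ => hs x),
      ← Finset.sum_image (s := q.support) (g := Subtype.val)
        (f := fun g => (if h : g ∈ G ∧ g ≠ 0 then q ⟨g, h⟩ else 0) * g)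
        (fun a _ b _ hab => Subtype.ext hab)]
    apply Finset.sum_subset
    · intro x hx
      obtain ⟨y, -, rfl⟩ := Finset.mem_image.mp hx
      exact y.2.1
    · intro x _ hx
      by_cases h : x ∈ G ∧ x ≠ 0
      · have : q ⟨x, h⟩ = 0 := by
          by_contra hq
          exact hx (Finset.mem_image.mpr ⟨⟨x, h⟩, Finsupp.mem_support_iff.mpr hq, rfl⟩)
        simp [dif_pos h, this]
      · simp [dif_neg h]
  · intro g _
    by_cases h : g ∈ G ∧ g ≠ 0
    · simpa only [dif_pos h, mul_comm] using h2 ⟨g, h⟩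
    · simp [dif_neg h]
  · intro s hs g hg hg0
    exact h3 s hs g ⟨hg, hg0⟩

/-- The normal form of `f` modulo `G`: its remainder on division by `G`. -/
def normalForm (ord : MonomialOrder σ) (G : Finset (MvPolynomial σ k))
    (f : MvPolynomial σ k) : MvPolynomial σ k :=
  Classical.choose (exists_isRemainder ord G f)

theorem normalForm_spec (ord : MonomialOrder σ) (G : Finset (MvPolynomial σ k))
    (f : MvPolynomial σ k) : IsRemainder ord G f (normalForm ord G f) :=
  Classical.choose_spec (exists_isRemainder ord G f)

/-- For a Gröbner basis the remainder is unique, so that `normalForm` involves no choice. -/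
theorem IsGroebnerBasis.normalForm_eq {ord : MonomialOrder σ} {G : Finset (MvPolynomial σ k)}
    {I : Ideal (MvPolynomial σ k)} (hG : IsGroebnerBasis ord G I) {f r : MvPolynomial σ k}
    (hr : IsRemainder ord G f r) : normalForm ord G f = r := by
  classical
  have mem : ∀ {r' : MvPolynomial σ k}, IsRemainder ord G f r' → f - r' ∈ I := by
    rintro r' ⟨q, h1, -, -⟩
    have h : f - r' = ∑ g ∈ G, q g * g := by rw [h1]; ring
    rw [h, ← hG.1]
    exact Ideal.sum_mem _ fun g hg => Ideal.mul_mem_left _ _ (Ideal.subset_span hg)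
  obtain ⟨-, -, -, h3⟩ := id hr
  obtain ⟨-, -, -, h3'⟩ := normalForm_spec ord G f
  by_contra hne
  have hI : normalForm ord G f - r ∈ I := by
    have := I.sub_mem (mem hr) (mem (normalForm_spec ord G f))
    simpa using this
  have hne' : normalForm ord G f - r ≠ 0 := sub_ne_zero.mpr hne
  obtain ⟨g, hg, hg0, hle⟩ := hG.2 _ hI hne'
  have hs := MvPolynomial.support_sub σ _ _ (ord.degree_mem_support hne')
  rcases Finset.mem_union.mp hs with h | h
  · exact h3' _ h g hg hg0 hle
  · exact h3 _ h g hg hg0 hle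

end Groebner

/-! ### Rational functions of the parameters and their values at a point -/

section Parameters

variable {m : ℕ}

/-- The field `ℂ(a₁, …, aₘ)`. -/
abbrev ParamField (m : ℕ) : Type := FractionRing (MvPolynomial (Fin m) ℂ)

/-- The numerator of a rational function in lowest terms. -/
def ratNum (x : ParamField m) : MvPolynomial (Fin m) ℂ :=
  IsFractionRing.num (MvPolynomial (Fin m) ℂ) x

/-- The denominator of a rational function in lowest terms. -/
def ratDen (x : ParamField m) : MvPolynomial (Fin m) ℂ :=
  (IsFractionRing.den (MvPolynomial (Fin m) ℂ) x : MvPolynomial (Fin m) ℂ)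

/-- The rational function `x` is analytic at the point `a`. -/
def RegularAt (a : Fin m → ℂ) (x : ParamField m) : Prop := eval a (ratDen x) ≠ 0

/-- The value at `a` of a rational function that is analytic at `a`. -/
def evalAt (a : Fin m → ℂ) (x : ParamField m) : ℂ := eval a (ratNum x) / eval a (ratDen x)

/-- The partial derivative `∂x/∂aⱼ` of a rational function, by the quotient rule. -/
def ratDeriv (j : Fin m) (x : ParamField m) : ParamField m :=
  algebraMap (MvPolynomial (Fin m) ℂ) (ParamField m)
      (pderiv j (ratNum x) * ratDen x - ratNum x * pderiv j (ratDen x)) /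
    algebraMap (MvPolynomial (Fin m) ℂ) (ParamField m) (ratDen x ^ 2)

end Parameters

/-! ### The two polynomial rings, specialisation and differentiation -/

section Polynomials

variable {m n : ℕ} {k : Type*} [Field k]

/-- The `2n` variables `∂z₁/∂aⱼ, …, ∂zₙ/∂aⱼ, z₁, …, zₙ`, in this order (the lexicographic sum). -/
abbrev JetVar (n : ℕ) : Type := Fin n ⊕ₗ Fin n

/-- The index of the formal variable `∂zᵢ/∂aⱼ`. -/
def dotVar (i : Fin n) : JetVar n := toLex (Sum.inl i)

/-- The index of the variable `zᵢ`. -/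
def zVar (i : Fin n) : JetVar n := toLex (Sum.inr i)

/-- The inclusion of `k[z₁, …, zₙ]` into `k[∂z₁/∂aⱼ, …, ∂zₙ/∂aⱼ, z₁, …, zₙ]`. -/
def incl : MvPolynomial (Fin n) k →ₐ[k] MvPolynomial (JetVar n) k := rename zVar

/-- `∑ i, ∂p/∂zᵢ * ∂zᵢ/∂aⱼ`: the derivative with respect to `aⱼ` of a polynomial in the `zᵢ` whose
coefficients are regarded as constants, the `zᵢ` being implicit functions of `aⱼ`. -/
def chainDeriv (p : MvPolynomial (Fin n) k) : MvPolynomial (JetVar n) k :=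
  ∑ i, incl (pderiv i p) * X (dotVar i)

/-- The polynomial `f(•; a)`, obtained by evaluating the coefficients at `a`. -/
def specialize {σ : Type*} (a : Fin m → ℂ) (f : MvPolynomial σ (ParamField m)) :
    MvPolynomial σ ℂ :=
  ∑ s ∈ f.support, monomial s (evalAt a (coeff s f))

/-- `∂f/∂aⱼ`, the coefficientwise derivative at fixed `z`. -/
def paramDeriv (j : Fin m) (f : MvPolynomial (Fin n) (ParamField m)) :
    MvPolynomial (Fin n) (ParamField m) :=
  ∑ s ∈ f.support, monomial s (ratDeriv j (coeff s f))

/-- The total derivative `df/daⱼ = ∂f/∂aⱼ + ∑ i, ∂f/∂zᵢ * ∂zᵢ/∂aⱼ`. -/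
def totalDeriv (j : Fin m) (f : MvPolynomial (Fin n) (ParamField m)) :
    MvPolynomial (JetVar n) (ParamField m) :=
  incl (paramDeriv j f) + chainDeriv f

/-- The ideal `I = ⟨f₁, …, fₙ⟩` of `ℂ(a)[z]`. -/
def genericIdeal (f : Fin n → MvPolynomial (Fin n) (ParamField m)) :
    Ideal (MvPolynomial (Fin n) (ParamField m)) :=
  Ideal.span (Set.range f)

/-- The ideal `I(a) = ⟨f₁(•; a), …, fₙ(•; a)⟩` of `ℂ[z]`. -/
def idealAt (f : Fin n → MvPolynomial (Fin n) (ParamField m)) (a : Fin m → ℂ) :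
    Ideal (MvPolynomial (Fin n) ℂ) :=
  Ideal.span (Set.range fun l => specialize a (f l))

/-- The ideal `Iⱼ(a)` generated by all `f_l(•; a)` and all `df_l/daⱼ(•; a)`. -/
def jetIdealAt (f : Fin n → MvPolynomial (Fin n) (ParamField m)) (j : Fin m) (a : Fin m → ℂ) :
    Ideal (MvPolynomial (JetVar n) ℂ) :=
  Ideal.map incl (idealAt f a) ⊔
    Ideal.span (Set.range fun l => specialize a (totalDeriv j (f l)))

/-- `a` is a generic point for `f₁, …, fₙ`: all coefficients are analytic at `a`, the complex
variety of `I(a)` is finite, and `I(a)` is radical. -/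
structure IsGenericParam (f : Fin n → MvPolynomial (Fin n) (ParamField m)) (a : Fin m → ℂ) :
    Prop where
  regular : ∀ l s, RegularAt a (coeff s (f l))
  finite_zeros : {ξ : Fin n → ℂ | ∀ p ∈ idealAt f a, eval ξ p = 0}.Finite
  isRadical : (idealAt f a).IsRadical

/-- The `i`-th companion matrix with respect to the Gröbner basis `G`, in the family of monomials
with exponents `e α`: its `(α, β)` entry is the coefficient of `e β` in the remainder of `zᵢ * e α`
on division by `G`. -/
def companionMatrix {d : ℕ} (ord : MonomialOrder (Fin n)) (G : Finset (MvPolynomial (Fin n) k))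
    (e : Fin d → Fin n →₀ ℕ) (i : Fin n) : Matrix (Fin d) (Fin d) k :=
  Matrix.of fun α β => coeff (e β) (normalForm ord G (X i * monomial (e α) 1))

end Polynomials

end CompanionDeriv

end

open CompanionDeriv

/-! Let `R` be the local ring of rational functions regular at `a`, `m` its maximal ideal, and `P`
the contraction of the generic ideal to `R[z]` (`integralIdeal`). The relations `z_i e_α - ∑ T_αβ
e_β` lie in `P`, and since the `T_i` have entries in `R`, the quotient `R[z]/P` is free over `R`
with basis `e`.

The crux is that `P` specialises into `I(a)` (`map_mem_span_of_mem_integralIdeal`). As `I(a)` is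
radical with finitely many zeros, the square system has invertible Jacobian at each zero, so Newton
iteration lifts the zero modulo every power of `m`. If `c p` lies in `(F)` with `c ≠ 0` but `p` does
not vanish at the zero, then `c` lies in all powers of `m`, against Krull's intersection theorem.
The Nullstellensatz then applies.

Freeness now gives `P ⊆ (F) + mP`, and Nakayama a polynomial `g` with `g(a) = 1` and `gP ⊆ (F)`.
Freeness also keeps the `e_β` independent modulo `I(a)`, so they remain the standard monomials.

Finally, `p ↦ p(a) + ε (dp/da_j)(a)` is a ring homomorphism to dual numbers (`jetEval`). Modulo the
jet ideal it kills `F` and sends `g` to a unit, so it kills `P`. Applied to the companion relations,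
its two components are the congruences behind the two reduction formulas; equality of the standard
bases makes the right-hand sides remainders. -/

namespace CompanionDeriv

/-! ### Normal forms and standard monomials -/

section Groebner

variable {σ k : Type*} [Field k] {ord : MonomialOrder σ} {G : Finset (MvPolynomial σ k)}
  {I : Ideal (MvPolynomial σ k)}

theorem IsGroebnerBasis.sub_normalForm_mem (hG : IsGroebnerBasis ord G I) (f : MvPolynomial σ k) :
    f - normalForm ord G f ∈ I := by
  obtain ⟨q, h1, -, -⟩ := normalForm_spec ord G f
  have h : f - normalForm ord G f = ∑ g ∈ G, q g * g := by
    nth_rewrite 1 [h1]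
    ring
  rw [h, ← hG.1]
  exact Ideal.sum_mem _ fun g hg => Ideal.mul_mem_left _ _ (Ideal.subset_span hg)

theorem mem_standardMonomials_of_mem_support_normalForm {f : MvPolynomial σ k} {s : σ →₀ ℕ}
    (hs : s ∈ (normalForm ord G f).support) : s ∈ standardMonomials ord G := by
  obtain ⟨-, -, -, h⟩ := normalForm_spec ord G f
  exact h s hs

/-- No quotient term exceeds the leading monomial of `f`. Hence a non-standard monomial leads the
relation obtained by reducing it, also after specialisation. -/
theorem le_degree_of_mem_support_normalForm {f : MvPolynomial σ k} {s : σ →₀ ℕ}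
    (hs : s ∈ (normalForm ord G f).support) : s ≼[ord] ord.degree f := by
  obtain ⟨q, h1, h2, -⟩ := normalForm_spec ord G f
  have h : normalForm ord G f = f - ∑ g ∈ G, q g * g := by
    nth_rewrite 2 [h1]
    ring
  by_contra hlt
  rw [not_le] at hlt
  refine mem_support_iff.mp hs ?_
  rw [h, coeff_sub, coeff_sum, ord.coeff_eq_zero_of_lt hlt, zero_sub, neg_eq_zero]
  exact Finset.sum_eq_zero fun g hg => ord.coeff_eq_zero_of_lt ((h2 g hg).trans_lt hlt)

theorem IsGroebnerBasis.eq_zero_of_mem (hG : IsGroebnerBasis ord G I) {f : MvPolynomial σ k}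
    (hf : f ∈ I) (hs : ∀ s ∈ f.support, s ∈ standardMonomials ord G) : f = 0 := by
  by_contra h0
  obtain ⟨g, hg, hg0, hle⟩ := hG.2 f hf h0
  exact hs _ (ord.degree_mem_support h0) g hg hg0 hle

theorem IsGroebnerBasis.normalForm_eq_of_sub_mem (hG : IsGroebnerBasis ord G I)
    {f r : MvPolynomial σ k} (hr : f - r ∈ I)
    (hs : ∀ s ∈ r.support, s ∈ standardMonomials ord G) : normalForm ord G f = r := by
  classical
  rw [← sub_eq_zero]
  refine hG.eq_zero_of_mem ?_ fun s h => ?_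
  · have := I.sub_mem hr (hG.sub_normalForm_mem f)
    rwa [sub_sub_sub_cancel_left] at this
  · rcases Finset.mem_union.mp (MvPolynomial.support_sub σ _ _ h) with h | h
    · exact mem_standardMonomials_of_mem_support_normalForm h
    · exact hs s h

theorem standardMonomials_of_le {s t : σ →₀ ℕ} (hts : t ≤ s)
    (hs : s ∈ standardMonomials ord G) : t ∈ standardMonomials ord G :=
  fun g hg hg0 hle => hs g hg hg0 (hle.trans hts)

/-- The leading monomials of the non-zero elements of the ideal are not standard. -/
theorem degree_notMem_standardMonomials (hG : IsGroebnerBasis ord G I) {f : MvPolynomial σ k}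
    (hf : f ∈ I) (h0 : f ≠ 0) : ord.degree f ∉ standardMonomials ord G := fun h => by
  obtain ⟨g, hg, hg0, hle⟩ := hG.2 f hf h0
  exact h g hg hg0 hle

end Groebner

/-! ### Linear combinations of a fixed family of monomials -/

section MonomialComb

variable {σ R : Type*} [CommRing R] {d : ℕ}

/-- The combination of the monomials with exponents `e β` with coefficients `r β`. -/
noncomputable def monomialComb (e : Fin d → σ →₀ ℕ) : (Fin d → R) →ₗ[R] MvPolynomial σ R where
  toFun r := ∑ β, monomial (e β) (r β)
  map_add' r s := by simp [Finset.sum_add_distrib]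
  map_smul' c r := by simp [Finset.smul_sum, smul_monomial]

theorem monomialComb_apply (e : Fin d → σ →₀ ℕ) (r : Fin d → R) :
    monomialComb e r = ∑ β, monomial (e β) (r β) := rfl

theorem coeff_monomialComb {e : Fin d → σ →₀ ℕ} (he : Function.Injective e) (r : Fin d → R)
    (β : Fin d) : coeff (e β) (monomialComb e r) = r β := by
  classical
  rw [monomialComb_apply, coeff_sum, Finset.sum_eq_single β]
  · simp
  · intro γ _ hγ
    rw [coeff_monomial, if_neg (fun h => hγ (he h))]
  · simp

theorem exists_of_mem_support_monomialComb {e : Fin d → σ →₀ ℕ} {r : Fin d → R}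
    {s : σ →₀ ℕ} (hs : s ∈ (monomialComb e r).support) : ∃ β, e β = s ∧ r β ≠ 0 := by
  classical
  by_contra h
  push Not at h
  refine mem_support_iff.mp hs ?_
  rw [monomialComb_apply, coeff_sum]
  refine Finset.sum_eq_zero fun β _ => ?_
  rw [coeff_monomial]
  split_ifs with hβ
  · exact h β hβ
  · rfl

theorem monomialComb_coeff {e : Fin d → σ →₀ ℕ} (he : Function.Injective e) {p : MvPolynomial σ R}
    (hp : ∀ s ∈ p.support, s ∈ Set.range e) : monomialComb e (fun β => coeff (e β) p) = p := by
  ext s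
  by_cases hs : s ∈ Set.range e
  · obtain ⟨β, rfl⟩ := hs
    rw [coeff_monomialComb he]
  · rw [notMem_support_iff.mp fun h => hs (hp s h)]
    by_contra h
    obtain ⟨β, hβ, -⟩ := exists_of_mem_support_monomialComb (mem_support_iff.mpr h)
    exact hs ⟨β, hβ⟩

theorem map_monomialComb {S : Type*} [CommRing S] (φ : R →+* S) (e : Fin d → σ →₀ ℕ)
    (r : Fin d → R) : map φ (monomialComb e r) = monomialComb e (fun β => φ (r β)) := by
  simp [monomialComb_apply, map_monomial]

theorem monomialComb_single (e : Fin d → σ →₀ ℕ) (β : Fin d) (c : R) :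
    monomialComb e (Pi.single β c) = monomial (e β) c := by
  classical
  rw [monomialComb_apply, Finset.sum_eq_single β]
  · simp
  · intro γ _ hγ
    simp [hγ]
  · simp

end MonomialComb

/-! ### Newton iteration and Krull's intersection theorem -/

section Newton

variable {σ R : Type*} [CommRing R]

/-- The first order Taylor formula modulo the square of an ideal. -/
theorem eval_add_sub_mem_sq [Fintype σ] (x δ : σ → R) (b : Ideal R) (hδ : ∀ i, δ i ∈ b)
    (p : MvPolynomial σ R) :
    eval (x + δ) p - eval x p - ∑ i, eval x (pderiv i p) * δ i ∈ b ^ 2 := by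
  classical
  induction p using MvPolynomial.induction_on with
  | C r => simp
  | add p q hp hq =>
    have := add_mem hp hq
    convert this using 1
    simp only [map_add, add_mul, Finset.sum_add_distrib]
    ring
  | mul_X p k hp =>
    have hL : ∑ i, eval x (pderiv i p) * δ i ∈ b :=
      Ideal.sum_mem _ fun i _ => Ideal.mul_mem_left _ _ (hδ i)
    have h1 : eval (x + δ) p - eval x p ∈ b := by
      have := add_mem (Ideal.pow_le_self two_ne_zero hp) hL
      simpa using this
    have h2 : (eval (x + δ) p - eval x p) * δ k ∈ b ^ 2 := by
      rw [sq]
      exact Ideal.mul_mem_mul h1 (hδ k)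
    have h3 := add_mem (Ideal.mul_mem_right (x k) _ hp) h2
    have h4 : ∑ i, eval x (pderiv i (p * X k)) * δ i =
        (∑ i, eval x (pderiv i p) * δ i) * x k + eval x p * δ k := by
      have : ∀ i, eval x (pderiv i (p * X k)) * δ i =
          eval x (pderiv i p) * δ i * x k + (if i = k then eval x p * δ k else 0) := by
        intro i
        rw [Derivation.leibniz, pderiv_X]
        by_cases h : i = k
        · subst h
          simp
          ring
        · simp [h, Ne.symm h]
          ring
      simp only [this, Finset.sum_add_distrib, Finset.sum_ite_eq', Finset.mem_univ, if_true,
        Finset.sum_mul]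
    rw [h4]
    convert h3 using 1
    simp only [map_mul, eval_X, Pi.add_apply]
    ring

/-- A zero of a square system modulo an ideal at which the Jacobian matrix is invertible lifts to
zeros modulo all powers of the ideal. -/
theorem exists_eval_mem_pow [Fintype σ] [DecidableEq σ] (F : σ → MvPolynomial σ R) (x₀ : σ → R)
    (m : Ideal R) (hx₀ : ∀ l, eval x₀ (F l) ∈ m) (H : Matrix σ σ R)
    (hH : ∀ l l', ∑ i, eval x₀ (pderiv i (F l)) * H i l' - (1 : Matrix σ σ R) l l' ∈ m) (N : ℕ) :
    ∃ x : σ → R, (∀ i, x i - x₀ i ∈ m) ∧ ∀ l, eval x (F l) ∈ m ^ (N + 1) := by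
  have key : ∀ (x : σ → R), (∀ i, x i - x₀ i ∈ m) → ∀ p, eval x p - eval x₀ p ∈ m := by
    intro x hx p
    rw [← Ideal.Quotient.eq, ← RingHom.comp_apply, ← RingHom.comp_apply]
    congr 1
    refine MvPolynomial.ringHom_ext (fun r => by simp) fun i => ?_
    simpa using Ideal.Quotient.eq.mpr (hx i)
  induction N with
  | zero => exact ⟨x₀, by simp, by simpa using hx₀⟩
  | succ N ih =>
    obtain ⟨x, hx, hF⟩ := ih
    -- Newton step with the inverse Jacobian frozen at `x₀`; linear convergence in powers of `m`
    -- suffices.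
    let δ : σ → R := fun i => -∑ l, H i l * eval x (F l)
    have hδ : ∀ i, δ i ∈ m ^ (N + 1) := fun i =>
      neg_mem (Ideal.sum_mem _ fun l _ => Ideal.mul_mem_left _ _ (hF l))
    have hle : (m ^ (N + 1)) ^ 2 ≤ m ^ (N + 1 + 1) := by
      rw [← pow_mul]
      exact Ideal.pow_le_pow_right (by omega)
    refine ⟨x + δ, fun i => ?_, fun l => ?_⟩
    · have := add_mem (hx i) (Ideal.pow_le_self (Nat.succ_ne_zero N) (hδ i))
      convert this using 1
      simp only [Pi.add_apply]
      ring
    · have h1 := hle (eval_add_sub_mem_sq x δ _ hδ (F l))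
      have h2 : eval x (F l) + ∑ i, eval x (pderiv i (F l)) * δ i =
          -∑ l', (∑ i, eval x (pderiv i (F l)) * H i l' - (1 : Matrix σ σ R) l l') *
            eval x (F l') := by
        have h3 : ∑ i, eval x (pderiv i (F l)) * δ i =
            -∑ l', (∑ i, eval x (pderiv i (F l)) * H i l') * eval x (F l') := by
          simp only [δ, mul_neg, Finset.sum_neg_distrib, neg_inj, Finset.mul_sum, Finset.sum_mul]
          rw [Finset.sum_comm]
          simp only [mul_assoc]
        simp only [h3, sub_mul, Finset.sum_sub_distrib, Matrix.one_apply, ite_mul, one_mul,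
          zero_mul, Finset.sum_ite_eq, Finset.mem_univ, if_true]
        ring
      have h4 : eval x (F l) + ∑ i, eval x (pderiv i (F l)) * δ i ∈ m ^ (N + 1 + 1) := by
        rw [h2, pow_succ']
        refine neg_mem (Ideal.sum_mem _ fun l' _ => Ideal.mul_mem_mul ?_ (hF l'))
        -- Since `x ≡ x₀` modulo `m`, the matrix `H` still inverts the Jacobian at `x` modulo `m`.
        have h5 : ∑ i, eval x (pderiv i (F l)) * H i l' - (1 : Matrix σ σ R) l l' =
            ∑ i, (eval x (pderiv i (F l)) - eval x₀ (pderiv i (F l))) * H i l' +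
              (∑ i, eval x₀ (pderiv i (F l)) * H i l' - (1 : Matrix σ σ R) l l') := by
          simp only [sub_mul, Finset.sum_sub_distrib]
          ring
        rw [h5]
        exact add_mem (Ideal.sum_mem _ fun i _ => Ideal.mul_mem_right _ _ (key x hx _)) (hH l l')
      have := add_mem h1 h4
      convert this using 1
      ring

/-- A polynomial of which a non-zero multiple lies in the ideal of a square system vanishes at the
zeros of the system modulo `m` at which the Jacobian matrix is invertible. -/
theorem eval_mem_of_C_mul_mem_span [Fintype σ] [DecidableEq σ] [IsDomain R] [IsNoetherianRing R]
    (F : σ → MvPolynomial σ R) (x₀ : σ → R) (m : Ideal R) (hm : m.IsMaximal)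
    (hx₀ : ∀ l, eval x₀ (F l) ∈ m) (H : Matrix σ σ R)
    (hH : ∀ l l', ∑ i, eval x₀ (pderiv i (F l)) * H i l' - (1 : Matrix σ σ R) l l' ∈ m)
    {c : R} (hc : c ≠ 0) {p : MvPolynomial σ R} (hp : C c * p ∈ Ideal.span (Set.range F)) :
    eval x₀ p ∈ m := by
  by_contra hpm
  refine hc ?_
  -- By Krull it is enough to place `c` in every power of `m`.
  rw [← Submodule.mem_bot R, ← Ideal.iInf_pow_eq_bot_of_isDomain m hm.ne_top]
  refine (Submodule.mem_iInf _).mpr fun N => Ideal.pow_le_pow_right (Nat.le_succ N) ?_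
  obtain ⟨x, hx, hF⟩ := exists_eval_mem_pow F x₀ m hx₀ H hH N
  have hcp : c * eval x p ∈ m ^ (N + 1) := by
    have hle : Ideal.span (Set.range F) ≤ (m ^ (N + 1)).comap (eval x) := by
      rw [Ideal.span_le]
      rintro _ ⟨l, rfl⟩
      exact hF l
    simpa using hle hp
  have hxp : eval x p ∉ m := by
    intro h
    refine hpm ?_
    have : eval x p - eval x₀ p ∈ m := by
      rw [← Ideal.Quotient.eq, ← RingHom.comp_apply, ← RingHom.comp_apply]
      congr 1
      refine MvPolynomial.ringHom_ext (fun r => by simp) fun i => ?_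
      simpa using Ideal.Quotient.eq.mpr (hx i)
    simpa using sub_mem h this
  -- Outside the maximal ideal `m`, the value of `p` is a unit modulo `m ^ (N + 1)` and can be
  -- cancelled from `c * eval x p`.
  have hsup : Ideal.span {eval x p} ⊔ m ^ (N + 1) = ⊤ := by
    refine Ideal.sup_pow_eq_top ?_
    rw [sup_comm]
    exact hm.out.2 _ (lt_of_le_of_ne le_sup_left fun h => hxp (h ▸ Ideal.mem_sup_right
      (Ideal.mem_span_singleton_self _)))
  obtain ⟨y, hy, z, hz, hyz⟩ := Submodule.mem_sup.mp ((Ideal.eq_top_iff_one _).mp hsup)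
  obtain ⟨w, rfl⟩ := Ideal.mem_span_singleton'.mp hy
  have h : c = w * (c * eval x p) + c * z := by linear_combination -c * hyz
  rw [h]
  exact add_mem (Ideal.mul_mem_left _ _ hcp) (Ideal.mul_mem_left _ _ hz)

end Newton

/-! ### Invertibility of the Jacobian at reduced isolated zeros -/

section Jacobian

variable {k : Type*} [Field k] {n : ℕ}

/-- A finite set of points is separated from each of its points by a polynomial. -/
theorem exists_eval_ne_zero_of_finite {V : Set (Fin n → k)} (hV : V.Finite) (ξ : Fin n → k) :
    ∃ g : MvPolynomial (Fin n) k, eval ξ g ≠ 0 ∧ ∀ η ∈ V, η ≠ ξ → eval η g = 0 := by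
  classical
  have h : ∀ η : Fin n → k, ∃ g : MvPolynomial (Fin n) k, η ≠ ξ → eval ξ g ≠ 0 ∧ eval η g = 0 := by
    intro η
    by_cases hη : η = ξ
    · exact ⟨0, fun h => absurd hη h⟩
    · obtain ⟨i, hi⟩ := Function.ne_iff.mp hη
      exact ⟨X i - C (η i), fun _ => ⟨by simpa [sub_eq_zero] using Ne.symm hi, by simp⟩⟩
  choose g hg using h
  refine ⟨∏ η ∈ hV.toFinset.erase ξ, g η, ?_, fun η hη hne => ?_⟩
  · rw [eval_prod, Finset.prod_ne_zero_iff]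
    exact fun η hη => (hg η (Finset.ne_of_mem_erase hη)).1
  · rw [eval_prod]
    exact Finset.prod_eq_zero (Finset.mem_erase.mpr ⟨hne, hV.mem_toFinset.mpr hη⟩) (hg η hne).2

/-- At the zeros of a radical zero-dimensional ideal generated by a square system the Jacobian
matrix of the system is invertible. -/
theorem exists_jacobian_mul_eq_one [IsAlgClosed k] (F : Fin n → MvPolynomial (Fin n) k)
    (hfin : {ξ : Fin n → k | ∀ p ∈ Ideal.span (Set.range F), eval ξ p = 0}.Finite)
    (hrad : (Ideal.span (Set.range F)).IsRadical) {ξ : Fin n → k} (hξ : ∀ l, eval ξ (F l) = 0) :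
    ∃ H : Matrix (Fin n) (Fin n) k, (Matrix.of fun l i => eval ξ (pderiv i (F l))) * H = 1 := by
  obtain ⟨g, hgξ, hg⟩ := exists_eval_ne_zero_of_finite hfin ξ
  -- The product vanishes at every zero: at `ξ` by its second factor, elsewhere by `g`.
  have hmem : ∀ i, g * (X i - C (ξ i)) ∈ Ideal.span (Set.range F) := by
    intro i
    rw [← hrad.radical, ← vanishingIdeal_zeroLocus_eq_radical (K := k), mem_vanishingIdeal_iff]
    intro η hη
    have hη' : ∀ p ∈ Ideal.span (Set.range F), eval η p = 0 := fun p hp => by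
      simpa [aeval_eq_eval] using hη p hp
    by_cases h : η = ξ
    · subst h
      simp
    · simp [aeval_eq_eval, hg η hη' h]
  have hex : ∀ i, ∃ h : Fin n → MvPolynomial (Fin n) k, ∑ l, h l * F l = g * (X i - C (ξ i)) :=
    fun i => Ideal.mem_span_range_iff_exists_fun.mp (hmem i)
  choose h hh using hex
  refine ⟨Matrix.of fun i l => eval ξ (h i l) / eval ξ g, ?_⟩
  rw [mul_eq_one_comm]
  ext i i'
  -- Differentiating at `ξ` kills the derivatives of the cofactors, because `F l` vanishes there.
  -- What remains is a left inverse, hence a two-sided one for a square matrix.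
  have h1 := congrArg (fun p => eval ξ (pderiv i' p)) (hh i)
  simp only [map_sum, Derivation.leibniz, map_add, smul_eq_mul, map_mul, hξ, zero_mul, add_zero,
    map_sub, eval_X, eval_C, sub_self, pderiv_C, sub_zero, pderiv_X] at h1
  simp only [Matrix.mul_apply, Matrix.of_apply, Matrix.one_apply, div_mul_eq_mul_div,
    ← Finset.sum_div, h1]
  by_cases hi : i = i'
  · subst hi
    simp [hgξ]
  · simp [hi]

end Jacobian

/-! ### The integral ideal and its specialisation -/

section Specialization

variable {k R K : Type*} [Field k] [CommRing R] [Field K] [Algebra k R] [Algebra R K]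
  {n d : ℕ}

/-- The polynomials over `R` in the ideal that the system `F` generates over `K`. -/
noncomputable def integralIdeal (K : Type*) [Field K] [Algebra R K]
    (F : Fin n → MvPolynomial (Fin n) R) : Ideal (MvPolynomial (Fin n) R) :=
  (Ideal.span (Set.range fun l => map (algebraMap R K) (F l))).comap (map (algebraMap R K))

theorem mem_integralIdeal {F : Fin n → MvPolynomial (Fin n) R} {p : MvPolynomial (Fin n) R} :
    p ∈ integralIdeal K F ↔
      map (algebraMap R K) p ∈ Ideal.span (Set.range fun l => map (algebraMap R K) (F l)) :=
  Iff.rfl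

theorem span_le_integralIdeal (F : Fin n → MvPolynomial (Fin n) R) :
    Ideal.span (Set.range F) ≤ integralIdeal K F := by
  rw [Ideal.span_le]
  rintro _ ⟨l, rfl⟩
  exact Ideal.subset_span ⟨l, rfl⟩

/-- `K[z]` is the localisation of `R[z]` at the non-zero constants, so one constant clears all
denominators. -/
theorem exists_C_mul_mem_span [IsDomain R] [IsFractionRing R K]
    {F : Fin n → MvPolynomial (Fin n) R} {p : MvPolynomial (Fin n) R}
    (hp : p ∈ integralIdeal K F) : ∃ c : R, c ≠ 0 ∧ C c * p ∈ Ideal.span (Set.range F) := by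
  let : Algebra (MvPolynomial (Fin n) R) (MvPolynomial (Fin n) K) := algebraMvPolynomial
  have hloc : IsLocalization ((nonZeroDivisors R).map (C (σ := Fin n))) (MvPolynomial (Fin n) K) :=
    MvPolynomial.isLocalization _ _
  have hI : Ideal.span (Set.range fun l => map (algebraMap R K) (F l)) =
      (Ideal.span (Set.range F)).map (algebraMap (MvPolynomial (Fin n) R)
        (MvPolynomial (Fin n) K)) := by
    rw [Ideal.map_span, ← Set.range_comp]
    rfl
  rw [mem_integralIdeal, hI] at hp
  have hp' : algebraMap (MvPolynomial (Fin n) R) (MvPolynomial (Fin n) K) p ∈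
      (Ideal.span (Set.range F)).map (algebraMap (MvPolynomial (Fin n) R)
        (MvPolynomial (Fin n) K)) := hp
  obtain ⟨⟨q, ⟨_, c, hc, rfl⟩⟩, h⟩ :=
    (IsLocalization.mem_map_algebraMap_iff ((nonZeroDivisors R).map (C (σ := Fin n))) _).mp hp'
  refine ⟨c, nonZeroDivisors.ne_zero hc, ?_⟩
  rw [← map_mul] at h
  have hinj : Function.Injective
      (algebraMap (MvPolynomial (Fin n) R) (MvPolynomial (Fin n) K)) :=
    map_injective _ (IsFractionRing.injective R K)
  rw [mul_comm]
  have h' := hinj h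
  simp only at h'
  rw [h']
  exact q.2

/-- If the specialised system generates a radical ideal with finitely many zeros, then the elements
of the integral ideal specialise to elements of this ideal. -/
theorem map_mem_span_of_mem_integralIdeal [IsAlgClosed k] [IsDomain R] [IsNoetherianRing R]
    [IsFractionRing R K] (ev : R →ₐ[k] k) (F : Fin n → MvPolynomial (Fin n) R)
    (hfin : {ξ : Fin n → k | ∀ p ∈ Ideal.span (Set.range fun l => map (ev : R →+* k) (F l)),
      eval ξ p = 0}.Finite)
    (hrad : (Ideal.span (Set.range fun l => map (ev : R →+* k) (F l))).IsRadical)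
    {p : MvPolynomial (Fin n) R} (hp : p ∈ integralIdeal K F) :
    map (ev : R →+* k) p ∈ Ideal.span (Set.range fun l => map (ev : R →+* k) (F l)) := by
  obtain ⟨c, hc, hcp⟩ := exists_C_mul_mem_span hp
  rw [← hrad.radical, ← vanishingIdeal_zeroLocus_eq_radical (K := k), mem_vanishingIdeal_iff]
  intro ξ hξ
  have hξ' : ∀ l, eval ξ (map (ev : R →+* k) (F l)) = 0 := fun l => by
    simpa [aeval_eq_eval] using hξ _ (Ideal.subset_span ⟨l, rfl⟩)
  obtain ⟨H, hH⟩ := exists_jacobian_mul_eq_one _ hfin hrad hξ'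
  have hev : ∀ q : MvPolynomial (Fin n) R, ev (eval (fun i => algebraMap k R (ξ i)) q) =
      eval ξ (map (ev : R →+* k) q) := by
    intro q
    rw [eval_map, ← AlgHom.coe_toRingHom, eval₂_comp]
    congr 1
    funext i
    simp
  have hmax : (RingHom.ker (ev : R →+* k)).IsMaximal :=
    RingHom.ker_isMaximal_of_surjective _ fun x => ⟨algebraMap k R x, by simp⟩
  -- The zero, and the inverse Jacobian at it, enter `R` as constants; they satisfy the required
  -- equations only modulo the kernel of `ev`.
  have h := eval_mem_of_C_mul_mem_span F (fun i => algebraMap k R (ξ i))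
    (RingHom.ker (ev : R →+* k)) hmax (fun l => by simpa [RingHom.mem_ker, hev] using hξ' l)
    (H.map (algebraMap k R)) (fun l l' => ?_) hc hcp
  · rw [aeval_eq_eval, ← hev]
    exact h
  · have h1 := congrFun (congrFun hH l) l'
    simp only [Matrix.mul_apply, Matrix.of_apply] at h1
    rw [RingHom.mem_ker]
    simp only [AlgHom.coe_toRingHom, map_sub, map_sum, map_mul, Matrix.map_apply, hev,
      ← pderiv_map, AlgHom.commutes, Algebra.algebraMap_self, RingHom.id_apply, h1]
    by_cases h : l = l' <;> simp [Matrix.one_apply, h]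

variable {ord : MonomialOrder (Fin n)} {G : Finset (MvPolynomial (Fin n) K)}
  {F : Fin n → MvPolynomial (Fin n) R} {e : Fin d → Fin n →₀ ℕ}
  {T : Fin n → Matrix (Fin d) (Fin d) R}

theorem normalForm_X_mul_eq (he : Function.Injective e)
    (he_range : Set.range e = standardMonomials ord G)
    (hT : ∀ i α β, algebraMap R K (T i α β) = companionMatrix ord G e i α β) (i : Fin n)
    (α : Fin d) : normalForm ord G (X i * monomial (e α) 1) =
      map (algebraMap R K) (monomialComb e (T i α)) := by
  rw [map_monomialComb]
  simp only [hT]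
  exact (monomialComb_coeff he fun s hs => he_range ▸
    mem_standardMonomials_of_mem_support_normalForm hs).symm

theorem X_mul_monomial_sub_mem_integralIdeal
    (hG : IsGroebnerBasis ord G (Ideal.span (Set.range fun l => map (algebraMap R K) (F l))))
    (he : Function.Injective e) (he_range : Set.range e = standardMonomials ord G)
    (hT : ∀ i α β, algebraMap R K (T i α β) = companionMatrix ord G e i α β) (i : Fin n)
    (α : Fin d) : X i * monomial (e α) 1 - monomialComb e (T i α) ∈ integralIdeal K F := by
  rw [mem_integralIdeal, map_sub, ← normalForm_X_mul_eq he he_range hT]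
  simpa [map_monomial] using hG.sub_normalForm_mem (X i * monomial (e α) 1)

/-- With `exists_sub_monomialComb_mem_integralIdeal`, this is the freeness of `R[z]` modulo the
integral ideal. -/
theorem eq_zero_of_monomialComb_mem_integralIdeal [IsDomain R] [IsFractionRing R K]
    (hG : IsGroebnerBasis ord G (Ideal.span (Set.range fun l => map (algebraMap R K) (F l))))
    (he : Function.Injective e) (he_range : Set.range e = standardMonomials ord G)
    {r : Fin d → R} (hr : monomialComb e r ∈ integralIdeal K F) : r = 0 := by
  rw [mem_integralIdeal] at hr
  have h0 := hG.eq_zero_of_mem hr fun s hs => by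
    rw [map_monomialComb] at hs
    obtain ⟨β, rfl, -⟩ := exists_of_mem_support_monomialComb hs
    rw [← he_range]
    exact ⟨β, rfl⟩
  have h1 : monomialComb e r = 0 :=
    map_injective _ (IsFractionRing.injective R K) (by rw [h0, map_zero])
  funext β
  rw [← coeff_monomialComb he r β, h1, coeff_zero, Pi.zero_apply]

/-- Modulo the integral ideal all polynomials over `R` are combinations over `R` of the standard
monomials. -/
theorem exists_sub_monomialComb_mem_integralIdeal
    (hG : IsGroebnerBasis ord G (Ideal.span (Set.range fun l => map (algebraMap R K) (F l))))
    (he : Function.Injective e) (he_range : Set.range e = standardMonomials ord G)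
    (hT : ∀ i α β, algebraMap R K (T i α β) = companionMatrix ord G e i α β)
    (p : MvPolynomial (Fin n) R) :
    ∃ r : Fin d → R, p - monomialComb e r ∈ integralIdeal K F := by
  have hone : ∃ r : Fin d → R, (1 : MvPolynomial (Fin n) R) - monomialComb e r ∈
      integralIdeal K F := by
    by_cases h : (0 : Fin n →₀ ℕ) ∈ Set.range e
    · obtain ⟨β, hβ⟩ := h
      refine ⟨Pi.single β 1, ?_⟩
      rw [monomialComb_single, hβ]
      simp
    -- Standard monomials are closed under divisors, so if `1` is not standard there are none and
    -- the ideal is the unit ideal.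
    · refine ⟨0, ?_⟩
      have h0 : normalForm ord G (map (algebraMap R K) (1 : MvPolynomial (Fin n) R)) = 0 := by
        rw [← support_eq_empty, Finset.eq_empty_iff_forall_notMem]
        intro s hs
        refine h ?_
        rw [he_range]
        exact standardMonomials_of_le (zero_le)
          (mem_standardMonomials_of_mem_support_normalForm hs)
      have := hG.sub_normalForm_mem (map (algebraMap R K) (1 : MvPolynomial (Fin n) R))
      rw [h0] at this
      simpa [mem_integralIdeal] using this
  induction p using MvPolynomial.induction_on with
  | C c =>
    obtain ⟨r, hr⟩ := hone
    refine ⟨c • r, ?_⟩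
    have := Ideal.mul_mem_left _ (C c) hr
    rwa [mul_sub, mul_one, ← smul_eq_C_mul _ c, ← map_smul] at this
  | add p q hp hq =>
    obtain ⟨r, hr⟩ := hp
    obtain ⟨s, hs⟩ := hq
    refine ⟨r + s, ?_⟩
    rw [map_add, add_sub_add_comm]
    exact add_mem hr hs
  | mul_X p i hp =>
    obtain ⟨r, hr⟩ := hp
    -- Multiplication by `z_i` acts on coefficient rows through `T i`, whose entries lie in `R`.
    refine ⟨∑ α, r α • T i α, ?_⟩
    have h1 := Ideal.mul_mem_left _ (X i) hr
    have h2 : ∑ α, C (r α) * (X i * monomial (e α) 1 - monomialComb e (T i α)) ∈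
        integralIdeal K F :=
      Ideal.sum_mem _ fun α _ => Ideal.mul_mem_left _ _
        (X_mul_monomial_sub_mem_integralIdeal hG he he_range hT i α)
    have := add_mem h1 h2
    convert this using 1
    have h3 : X i * monomialComb e r = ∑ α, C (r α) * (X i * monomial (e α) 1) := by
      rw [monomialComb_apply, Finset.mul_sum]
      refine Finset.sum_congr rfl fun α _ => ?_
      rw [mul_left_comm, C_mul_monomial, mul_one]
    simp only [mul_sub, Finset.sum_sub_distrib, h3, map_sum, map_smul, smul_eq_C_mul]
    ring

/-- Reduction is linear over `R`, so a factor from `𝔞` survives both in the coefficients and in the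
error. The sharp error term is what Nakayama needs. -/
theorem exists_sub_monomialComb_mem_map_mul
    (hG : IsGroebnerBasis ord G (Ideal.span (Set.range fun l => map (algebraMap R K) (F l))))
    (he : Function.Injective e) (he_range : Set.range e = standardMonomials ord G)
    (hT : ∀ i α β, algebraMap R K (T i α β) = companionMatrix ord G e i α β) (𝔞 : Ideal R)
    {p : MvPolynomial (Fin n) R} (hp : p ∈ 𝔞.map C) :
    ∃ r : Fin d → R, (∀ β, r β ∈ 𝔞) ∧ p - monomialComb e r ∈ 𝔞.map C * integralIdeal K F := by
  rw [Ideal.map] at hp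
  induction hp using Submodule.closure_induction with
  | zero => exact ⟨0, by simp, by simp⟩
  | add p q _ _ hp hq =>
    obtain ⟨r, hr, hr'⟩ := hp
    obtain ⟨s, hs, hs'⟩ := hq
    refine ⟨r + s, fun β => add_mem (hr β) (hs β), ?_⟩
    rw [map_add, add_sub_add_comm]
    exact add_mem hr' hs'
  | smul_mem h p hp =>
    obtain ⟨c, hc, rfl⟩ := hp
    obtain ⟨r, hr⟩ := exists_sub_monomialComb_mem_integralIdeal hG he he_range hT h
    refine ⟨c • r, fun β => Ideal.mul_mem_right _ _ hc, ?_⟩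
    have := Ideal.mul_mem_mul (Ideal.mem_map_of_mem (C (σ := Fin n)) hc) hr
    rwa [mul_sub, ← smul_eq_C_mul (monomialComb e r) c, ← map_smul, mul_comm (C c) h] at this

variable {ev : R →ₐ[k] k}

/-- Near the point `ev` the integral ideal is generated by the system. -/
theorem exists_mul_mem_span_of_integralIdeal_specializes [IsDomain R] [IsNoetherianRing R]
    [IsFractionRing R K]
    (hG : IsGroebnerBasis ord G (Ideal.span (Set.range fun l => map (algebraMap R K) (F l))))
    (he : Function.Injective e) (he_range : Set.range e = standardMonomials ord G)
    (hT : ∀ i α β, algebraMap R K (T i α β) = companionMatrix ord G e i α β)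
    (hspec : ∀ p ∈ integralIdeal K F, map (ev : R →+* k) p ∈
      Ideal.span (Set.range fun l => map (ev : R →+* k) (F l))) :
    ∃ g : MvPolynomial (Fin n) R, map (ev : R →+* k) g = 1 ∧
      ∀ p ∈ integralIdeal K F, g * p ∈ Ideal.span (Set.range F) := by
  have hker : RingHom.ker (map (σ := Fin n) (ev : R →+* k)) =
      (RingHom.ker (ev : R →+* k)).map C := ker_map _
  have hle : integralIdeal K F ≤ Ideal.span (Set.range F) ⊔
      (RingHom.ker (ev : R →+* k)).map (C (σ := Fin n)) • integralIdeal K F := by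
    intro p hp
    obtain ⟨h, hh⟩ := Ideal.mem_span_range_iff_exists_fun.mp (hspec p hp)
    let h' : Fin n → MvPolynomial (Fin n) R := fun l => map (algebraMap k R) (h l)
    have hspan : ∑ l, h' l * F l ∈ Ideal.span (Set.range F) :=
      Ideal.mem_span_range_iff_exists_fun.mpr ⟨h', rfl⟩
    have hev : (ev : R →+* k).comp (algebraMap k R) = RingHom.id k := by
      ext x
      simp
    have hq : p - ∑ l, h' l * F l ∈ (RingHom.ker (ev : R →+* k)).map C := by
      rw [← hker, RingHom.mem_ker, map_sub, map_sum, ← hh, sub_eq_zero]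
      simp only [map_mul, h', map_map, hev, map_id]
    obtain ⟨r, -, hr⟩ := exists_sub_monomialComb_mem_map_mul hG he he_range hT _ hq
    have hr0 : monomialComb e r ∈ integralIdeal K F := by
      have h1 : p - ∑ l, h' l * F l - monomialComb e r ∈ integralIdeal K F :=
        Ideal.mul_le_right hr
      have h2 := sub_mem (sub_mem hp (span_le_integralIdeal (K := K) F hspan)) h1
      rwa [sub_sub_cancel] at h2
    -- By independence the reduced part vanishes, so the difference lies in the product ideal
    -- itself, not merely in the intersection.
    rw [eq_zero_of_monomialComb_mem_integralIdeal hG he he_range hr0, map_zero, sub_zero] at hr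
    exact Submodule.mem_sup.mpr ⟨_, hspan, _, hr, add_sub_cancel _ _⟩
  -- `R[z]` need not be local, so Nakayama yields containment only after multiplication by some `g`
  -- congruent to `1`.
  obtain ⟨g, hg, hgle⟩ := Submodule.exists_sub_one_mem_and_smul_le_of_fg_of_le_sup
    (IsNoetherian.noetherian (integralIdeal K F)) le_rfl hle
  refine ⟨g, ?_, fun p hp => hgle ?_⟩
  · rw [← hker, RingHom.mem_ker, map_sub, map_one, sub_eq_zero] at hg
    exact hg
  · exact Submodule.smul_mem_pointwise_smul p g _ hp

/-- The standard monomials remain linearly independent modulo the specialised ideal. -/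
theorem eq_zero_of_monomialComb_mem_span [IsDomain R] [IsFractionRing R K]
    (hG : IsGroebnerBasis ord G (Ideal.span (Set.range fun l => map (algebraMap R K) (F l))))
    (he : Function.Injective e) (he_range : Set.range e = standardMonomials ord G)
    (hT : ∀ i α β, algebraMap R K (T i α β) = companionMatrix ord G e i α β) {c : Fin d → k}
    (hc : monomialComb e c ∈ Ideal.span (Set.range fun l => map (ev : R →+* k) (F l))) :
    c = 0 := by
  have hker : RingHom.ker (map (σ := Fin n) (ev : R →+* k)) =
      (RingHom.ker (ev : R →+* k)).map C := ker_map _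
  obtain ⟨h, hh⟩ := Ideal.mem_span_range_iff_exists_fun.mp hc
  let h' : Fin n → MvPolynomial (Fin n) R := fun l => map (algebraMap k R) (h l)
  have hspan : ∑ l, h' l * F l ∈ Ideal.span (Set.range F) :=
    Ideal.mem_span_range_iff_exists_fun.mpr ⟨h', rfl⟩
  have hev : (ev : R →+* k).comp (algebraMap k R) = RingHom.id k := by
    ext x
    simp
  have hq : monomialComb e (fun β => algebraMap k R (c β)) - ∑ l, h' l * F l ∈
      (RingHom.ker (ev : R →+* k)).map C := by
    rw [← hker, RingHom.mem_ker, map_sub, map_sum, map_monomialComb, sub_eq_zero]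
    simp only [map_mul, h', map_map, hev, map_id, hh, AlgHom.coe_toRingHom, AlgHom.commutes,
      Algebra.algebraMap_self, RingHom.id_apply]
  obtain ⟨r, hr, hr'⟩ := exists_sub_monomialComb_mem_map_mul hG he he_range hT _ hq
  have hmem : monomialComb e ((fun β => algebraMap k R (c β)) - r) ∈ integralIdeal K F := by
    have h1 : monomialComb e (fun β => algebraMap k R (c β)) - ∑ l, h' l * F l -
        monomialComb e r ∈ integralIdeal K F := Ideal.mul_le_right hr'
    have h2 := add_mem h1 (span_le_integralIdeal (K := K) F hspan)
    rwa [sub_right_comm, sub_add_cancel, ← map_sub] at h2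
  have h0 := eq_zero_of_monomialComb_mem_integralIdeal hG he he_range hmem
  funext β
  have h1 := congrFun h0 β
  simp only [Pi.sub_apply, Pi.zero_apply, sub_eq_zero] at h1
  -- The constant `c β` equals an element of the kernel of `ev`, so it is zero.
  have h2 := hr β
  rw [← h1, RingHom.mem_ker] at h2
  simpa using h2

/-- The standard monomials do not change under specialisation. -/
theorem standardMonomials_specialization [IsDomain R] [IsFractionRing R K]
    (hG : IsGroebnerBasis ord G (Ideal.span (Set.range fun l => map (algebraMap R K) (F l))))
    (he : Function.Injective e) (he_range : Set.range e = standardMonomials ord G)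
    (hT : ∀ i α β, algebraMap R K (T i α β) = companionMatrix ord G e i α β)
    (hspec : ∀ p ∈ integralIdeal K F, map (ev : R →+* k) p ∈
      Ideal.span (Set.range fun l => map (ev : R →+* k) (F l)))
    {Ga : Finset (MvPolynomial (Fin n) k)}
    (hGa : IsGroebnerBasis ord Ga (Ideal.span (Set.range fun l => map (ev : R →+* k) (F l)))) :
    standardMonomials ord Ga = Set.range e := by
  have hsub : standardMonomials ord Ga ⊆ Set.range e := by
    intro s hs
    by_contra hse
    obtain ⟨r, hr⟩ := exists_sub_monomialComb_mem_integralIdeal hG he he_range hT (monomial s 1)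
    have hnf : normalForm ord G (monomial s 1) = map (algebraMap R K) (monomialComb e r) := by
      refine hG.normalForm_eq_of_sub_mem ?_ fun t ht => ?_
      · rw [mem_integralIdeal] at hr
        simpa [map_monomial] using hr
      · rw [map_monomialComb] at ht
        obtain ⟨β, rfl, -⟩ := exists_of_mem_support_monomialComb ht
        exact he_range ▸ ⟨β, rfl⟩
    -- Specialisation can only delete terms, so `s` stays the leading monomial of a relation, now in
    -- the specialised ideal.
    have hlt : ∀ t ∈ (monomialComb e fun β => ev (r β)).support, t ≺[ord] s := by
      intro t ht
      obtain ⟨β, rfl, hβ⟩ := exists_of_mem_support_monomialComb ht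
      have hmem : e β ∈ (normalForm ord G (monomial s 1)).support := by
        rw [mem_support_iff, hnf, map_monomialComb, coeff_monomialComb he]
        intro h0
        have : r β = 0 := IsFractionRing.injective R K (by simpa using h0)
        simp [this] at hβ
      refine lt_of_le_of_ne ((le_degree_of_mem_support_normalForm hmem).trans
        (ord.degree_monomial_le _)) fun heq => hse ⟨β, ord.toSyn.injective heq⟩
    have hp := hspec _ hr
    rw [map_sub, map_monomial, map_one, map_monomialComb] at hp
    simp only [AlgHom.coe_toRingHom] at hp
    have hs' : s ∈ (monomial s (1 : k) - monomialComb e fun β => ev (r β)).support := by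
      rw [mem_support_iff, coeff_sub, coeff_monomial, if_pos rfl,
        notMem_support_iff.mp fun h => (hlt s h).ne rfl, sub_zero]
      exact one_ne_zero
    have hne : (monomial s (1 : k) - monomialComb e fun β => ev (r β)) ≠ 0 := fun h0 => by
      simp [h0] at hs'
    refine degree_notMem_standardMonomials hGa hp hne ?_
    convert hs
    refine ord.toSyn.injective (le_antisymm ?_ (ord.le_degree hs'))
    rw [ord.degree_le_iff]
    intro t ht
    classical
    rcases Finset.mem_union.mp (MvPolynomial.support_sub _ _ _ ht) with h | h
    · rw [Finset.mem_singleton.mp (support_monomial_subset h)]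
    · exact (hlt t h).le
  refine hsub.antisymm ?_
  rintro _ ⟨α, rfl⟩
  by_contra hα
  have hmem := hGa.sub_normalForm_mem (monomial (e α) 1)
  set q := normalForm ord Ga (monomial (e α) 1)
  have hqs : ∀ s ∈ q.support, s ∈ standardMonomials ord Ga := fun s hs =>
    mem_standardMonomials_of_mem_support_normalForm hs
  -- If `e α` were not standard, its normal form would express it through the other `e β`, against
  -- independence.
  rw [← monomialComb_coeff he fun s hs => hsub (hqs s hs), ← monomialComb_single, ← map_sub] at hmem
  have h0 := congrFun (eq_zero_of_monomialComb_mem_span hG he he_range hT hmem) α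
  rw [Pi.sub_apply, Pi.single_eq_same, notMem_support_iff.mp fun h => hα (hqs _ h)] at h0
  simp at h0

end Specialization

/-! ### The local ring at a point and its first-order jets -/

section RationalFunctions

variable {m : ℕ}

theorem ratDen_ne_zero (x : ParamField m) : ratDen x ≠ 0 :=
  nonZeroDivisors.ne_zero (IsFractionRing.den (MvPolynomial (Fin m) ℂ) x).2

theorem ratNum_mul_eq {x : ParamField m} {p q : MvPolynomial (Fin m) ℂ} (hq : q ≠ 0)
    (hx : x = algebraMap _ _ p / algebraMap _ _ q) : ratNum x * q = p * ratDen x := by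
  have hinj := IsFractionRing.injective (MvPolynomial (Fin m) ℂ) (ParamField m)
  have h1 : x = algebraMap _ (ParamField m) (ratNum x) / algebraMap _ _ (ratDen x) := by
    conv_lhs => rw [← IsFractionRing.mk'_num_den (MvPolynomial (Fin m) ℂ) x]
    rw [IsFractionRing.mk'_eq_div]
    rfl
  have hq' : algebraMap _ (ParamField m) q ≠ 0 := (map_ne_zero_iff _ hinj).mpr hq
  have hd' : algebraMap _ (ParamField m) (ratDen x) ≠ 0 :=
    (map_ne_zero_iff _ hinj).mpr (ratDen_ne_zero x)
  have h2 := hx.symm.trans h1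
  rw [div_eq_div_iff hq' hd'] at h2
  apply hinj
  rw [map_mul, map_mul, h2]

/-- The denominator in lowest terms divides every other denominator. -/
theorem regularAt_of_eq_div {a : Fin m → ℂ} {x : ParamField m} {p q : MvPolynomial (Fin m) ℂ}
    (hq : eval a q ≠ 0) (hx : x = algebraMap _ _ p / algebraMap _ _ q) : RegularAt a x := by
  have hq0 : q ≠ 0 := fun h => hq (by simp [h])
  have h := ratNum_mul_eq hq0 hx
  have hrel : IsRelPrime (ratDen x) (ratNum x) :=
    (IsFractionRing.num_den_reduced (MvPolynomial (Fin m) ℂ) x).symm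
  obtain ⟨c, hc⟩ : ratDen x ∣ q := hrel.dvd_of_dvd_mul_left ⟨p, by rw [h, mul_comm]⟩
  intro h0
  apply hq
  rw [hc, map_mul, h0, zero_mul]

theorem evalAt_of_eq_div {a : Fin m → ℂ} {x : ParamField m} {p q : MvPolynomial (Fin m) ℂ}
    (hq : eval a q ≠ 0) (hx : x = algebraMap _ _ p / algebraMap _ _ q) :
    evalAt a x = eval a p / eval a q := by
  have hq0 : q ≠ 0 := fun h => hq (by simp [h])
  have h := congrArg (eval a) (ratNum_mul_eq hq0 hx)
  rw [evalAt, div_eq_div_iff (regularAt_of_eq_div hq hx) hq]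
  simpa using h

theorem evalAt_ratDeriv_of_eq_div {a : Fin m → ℂ} (j : Fin m) {x : ParamField m}
    {p q : MvPolynomial (Fin m) ℂ} (hq : eval a q ≠ 0)
    (hx : x = algebraMap _ _ p / algebraMap _ _ q) :
    evalAt a (ratDeriv j x) =
      (eval a (pderiv j p) * eval a q - eval a p * eval a (pderiv j q)) / eval a q ^ 2 := by
  have hq0 : q ≠ 0 := fun h => hq (by simp [h])
  have hd : eval a (ratDen x) ≠ 0 := regularAt_of_eq_div hq hx
  have h1 := ratNum_mul_eq hq0 hx
  have h2 := congrArg (fun f => eval a (pderiv j f)) h1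
  have h3 := congrArg (eval a) h1
  simp only [Derivation.leibniz, smul_eq_mul, map_add, map_mul] at h2 h3
  rw [evalAt_of_eq_div (by simpa using hd) (rfl : ratDeriv j x = _), map_pow,
    div_eq_div_iff (pow_ne_zero 2 hd) (pow_ne_zero 2 hq)]
  simp only [map_sub, map_mul]
  -- `h3` is the cross-multiplied equality of the two fractions and `h2` its derivative.
  linear_combination eval a (ratDen x) * eval a q * h2 -
    (eval a (pderiv j (ratDen x)) * eval a q + eval a (ratDen x) * eval a (pderiv j q)) * h3

theorem regularAt_ratDeriv {a : Fin m → ℂ} (j : Fin m) {x : ParamField m} (hx : RegularAt a x) :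
    RegularAt a (ratDeriv j x) :=
  regularAt_of_eq_div (q := ratDen x ^ 2) (by simpa using show eval a (ratDen x) ≠ 0 from hx) rfl

/-- The polynomials that do not vanish at `a`. -/
noncomputable def nonvanishing (a : Fin m → ℂ) : Submonoid (MvPolynomial (Fin m) ℂ) :=
  (nonZeroDivisors ℂ).comap (eval a)

theorem mem_nonvanishing {a : Fin m → ℂ} {q : MvPolynomial (Fin m) ℂ} :
    q ∈ nonvanishing a ↔ eval a q ≠ 0 :=
  mem_nonZeroDivisors_iff_ne_zero

theorem nonvanishing_le (a : Fin m → ℂ) :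
    nonvanishing a ≤ nonZeroDivisors (MvPolynomial (Fin m) ℂ) := fun q hq =>
  mem_nonZeroDivisors_of_ne_zero fun h => mem_nonvanishing.mp hq (by simp [h])

/-- The local ring of the rational functions that are analytic at `a`. -/
noncomputable abbrev RegularRing (a : Fin m → ℂ) :
    Subalgebra (MvPolynomial (Fin m) ℂ) (ParamField m) :=
  Localization.subalgebra.ofField (ParamField m) (nonvanishing a) (nonvanishing_le a)

theorem exists_eq_div (a : Fin m → ℂ) (r : RegularRing a) :
    ∃ p q : MvPolynomial (Fin m) ℂ, eval a q ≠ 0 ∧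
      (r : ParamField m) = algebraMap _ _ p / algebraMap _ _ q := by
  obtain ⟨p, q, hq, h⟩ := r.2
  exact ⟨p, q, mem_nonvanishing.mp hq, by rw [h, div_eq_mul_inv]⟩

theorem regularAt_iff_mem {a : Fin m → ℂ} {x : ParamField m} :
    RegularAt a x ↔ x ∈ RegularRing a := by
  refine ⟨fun h => ⟨ratNum x, ratDen x, mem_nonvanishing.mpr h, ?_⟩, fun h => ?_⟩
  · conv_lhs => rw [← IsFractionRing.mk'_num_den (MvPolynomial (Fin m) ℂ) x]
    rw [IsFractionRing.mk'_eq_div, div_eq_mul_inv]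
    rfl
  · obtain ⟨p, q, hq, hx⟩ := exists_eq_div a ⟨x, h⟩
    exact regularAt_of_eq_div hq hx

instance isNoetherianRing_regularRing (a : Fin m → ℂ) : IsNoetherianRing (RegularRing a) :=
  IsLocalization.isNoetherianRing (nonvanishing a) _ inferInstance

/-- The value and the derivative at `a` in the direction of the `j`-th coordinate. -/
noncomputable def dualEval (a : Fin m → ℂ) (j : Fin m) :
    MvPolynomial (Fin m) ℂ →+* DualNumber ℂ :=
  eval₂Hom (TrivSqZeroExt.inlHom ℂ ℂ)
    fun i => TrivSqZeroExt.inl (a i) + TrivSqZeroExt.inr (Pi.single j 1 i)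

/-- Taylor expansion at `a + ε e_j`, exact because `ε² = 0`. -/
theorem dualEval_apply (a : Fin m → ℂ) (j : Fin m) (p : MvPolynomial (Fin m) ℂ) :
    dualEval a j p = TrivSqZeroExt.inl (eval a p) + TrivSqZeroExt.inr (eval a (pderiv j p)) := by
  induction p using MvPolynomial.induction_on with
  | C c => ext <;> simp [dualEval]
  | add p q hp hq =>
    rw [map_add, hp, hq]
    ext <;> simp
  | mul_X p i hp =>
    rw [map_mul, hp]
    ext
    · simp [dualEval]
    · by_cases h : i = j
      · subst h
        simp [dualEval, mul_comm, add_comm]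
      · simp [dualEval, pderiv_X, Pi.single_apply, h, mul_comm]

/-- The value and the derivative at `a` of a rational function that is analytic at `a`. -/
noncomputable def dualEvalRegular (a : Fin m → ℂ) (j : Fin m) : RegularRing a →+* DualNumber ℂ :=
  IsLocalization.lift (M := nonvanishing a) (g := dualEval a j) fun q => by
    rw [TrivSqZeroExt.isUnit_iff_isUnit_fst, dualEval_apply]
    simpa using mem_nonvanishing.mp q.2

/-- Solving `r q = p` in the dual numbers gives the quotient rule, which ties the ring homomorphism
to `evalAt` and `ratDeriv`. -/
theorem dualEvalRegular_apply (a : Fin m → ℂ) (j : Fin m) (r : RegularRing a) :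
    dualEvalRegular a j r = TrivSqZeroExt.inl (evalAt a (r : ParamField m)) +
      TrivSqZeroExt.inr (evalAt a (ratDeriv j (r : ParamField m))) := by
  obtain ⟨p, q, hq, hr⟩ := exists_eq_div a r
  rw [evalAt_of_eq_div hq hr, evalAt_ratDeriv_of_eq_div j hq hr]
  have hq' : algebraMap _ (ParamField m) q ≠ 0 :=
    (map_ne_zero_iff _ (IsFractionRing.injective _ _)).mpr fun h => hq (by simp [h])
  have h : r * algebraMap _ (RegularRing a) q = algebraMap _ (RegularRing a) p := by
    apply Subtype.ext
    rw [eq_div_iff hq'] at hr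
    exact hr
  have h1 := congrArg (dualEvalRegular a j) h
  simp only [map_mul, dualEvalRegular, IsLocalization.lift_eq, dualEval_apply] at h1
  have h2 := congrArg TrivSqZeroExt.fst h1
  have h3 := congrArg TrivSqZeroExt.snd h1
  simp only [TrivSqZeroExt.fst_mul, TrivSqZeroExt.snd_mul, TrivSqZeroExt.fst_add,
    TrivSqZeroExt.snd_add, TrivSqZeroExt.fst_inl, TrivSqZeroExt.fst_inr, TrivSqZeroExt.snd_inl,
    TrivSqZeroExt.snd_inr, add_zero, zero_add, smul_eq_mul, MulOpposite.smul_eq_mul_unop,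
    MulOpposite.unop_op] at h2 h3
  rw [← eq_div_iff hq] at h2
  ext
  · simpa [dualEvalRegular] using h2
  · simp only [TrivSqZeroExt.snd_add, TrivSqZeroExt.snd_inl, TrivSqZeroExt.snd_inr, zero_add]
    rw [h2] at h3
    rw [eq_div_iff (pow_ne_zero 2 hq)]
    field_simp at h3
    simp only [dualEvalRegular]
    linear_combination h3

/-- Evaluation at `a` of the rational functions that are analytic at `a`. -/
noncomputable def evalRegular (a : Fin m → ℂ) : RegularRing a →ₐ[ℂ] ℂ :=
  { IsLocalization.lift (M := nonvanishing a) (g := eval a) fun q => by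
      simpa using mem_nonvanishing.mp q.2 with
    commutes' := fun c => by
      have : algebraMap ℂ (RegularRing a) c =
          algebraMap (MvPolynomial (Fin m) ℂ) (RegularRing a) (C c) :=
        IsScalarTower.algebraMap_apply ℂ (MvPolynomial (Fin m) ℂ) (RegularRing a) c
      change IsLocalization.lift _ _ = _
      rw [this, IsLocalization.lift_eq]
      simp }

theorem evalRegular_apply (a : Fin m → ℂ) (r : RegularRing a) :
    evalRegular a r = evalAt a (r : ParamField m) := by
  obtain ⟨p, q, hq, hr⟩ := exists_eq_div a r
  rw [evalAt_of_eq_div hq hr, eq_div_iff hq]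
  have hq' : algebraMap _ (ParamField m) q ≠ 0 :=
    (map_ne_zero_iff _ (IsFractionRing.injective _ _)).mpr fun h => hq (by simp [h])
  have h : r * algebraMap _ (RegularRing a) q = algebraMap _ (RegularRing a) p := by
    apply Subtype.ext
    rw [eq_div_iff hq'] at hr
    exact hr
  have hA : ∀ p, evalRegular a (algebraMap _ (RegularRing a) p) = eval a p := fun p =>
    IsLocalization.lift_eq _ _
  have h1 := congrArg (evalRegular a) h
  rwa [map_mul, hA, hA] at h1

end RationalFunctions

/-! ### Total derivatives as a homomorphism to dual numbers -/

section Jets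

variable {m n : ℕ}

theorem exists_map_eq_of_regularAt {σ : Type*} {a : Fin m → ℂ} {f : MvPolynomial σ (ParamField m)}
    (hf : ∀ s, RegularAt a (coeff s f)) :
    ∃ F : MvPolynomial σ (RegularRing a),
      map (algebraMap (RegularRing a) (ParamField m)) F = f := by
  refine mem_range_map_iff_coeffs_subset.mpr fun x hx => ?_
  obtain ⟨s, -, rfl⟩ := mem_coeffs_iff.mp hx
  exact ⟨⟨_, regularAt_iff_mem.mp (hf s)⟩, rfl⟩

theorem evalAt_zero (a : Fin m → ℂ) : evalAt a (0 : ParamField m) = 0 := by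
  simpa using evalAt_of_eq_div (a := a) (p := 0) (q := 1) (x := 0) (by simp) (by simp)

theorem ratDeriv_zero (j : Fin m) : ratDeriv j (0 : ParamField m) = 0 := by
  have h : ratNum (0 : ParamField m) = 0 := by
    simpa using ratNum_mul_eq (x := (0 : ParamField m)) (p := 0) (q := 1) one_ne_zero (by simp)
  simp [ratDeriv, h]

theorem coeff_specialize {σ : Type*} (a : Fin m → ℂ) (f : MvPolynomial σ (ParamField m))
    (t : σ →₀ ℕ) : coeff t (specialize a f) = evalAt a (coeff t f) := by
  classical
  simp only [specialize, coeff_sum, coeff_monomial, Finset.sum_ite_eq', mem_support_iff]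
  split_ifs with h
  · rfl
  · rw [not_not.mp h, evalAt_zero]

theorem specialize_map {σ : Type*} (a : Fin m → ℂ) (F : MvPolynomial σ (RegularRing a)) :
    specialize a (map (algebraMap (RegularRing a) (ParamField m)) F) =
      map (evalRegular a : RegularRing a →+* ℂ) F := by
  ext t
  rw [coeff_specialize, coeff_map, coeff_map]
  exact (evalRegular_apply a _).symm

theorem coeff_paramDeriv (j : Fin m) (f : MvPolynomial (Fin n) (ParamField m)) (t : Fin n →₀ ℕ) :
    coeff t (paramDeriv j f) = ratDeriv j (coeff t f) := by
  classical
  simp only [paramDeriv, coeff_sum, coeff_monomial, Finset.sum_ite_eq', mem_support_iff]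
  split_ifs with h
  · rfl
  · rw [not_not.mp h, ratDeriv_zero]

/-- The map of dual numbers induced by a homomorphism of the coefficients. -/
def dualNumberMap {S S' : Type*} [CommRing S] [CommRing S'] (φ : S →+* S') :
    DualNumber S →+* DualNumber S' where
  toFun x := TrivSqZeroExt.inl (φ x.fst) + TrivSqZeroExt.inr (φ x.snd)
  map_zero' := by ext <;> simp
  map_one' := by ext <;> simp
  map_add' x y := by ext <;> simp
  map_mul' x y := by ext <;> simp

theorem fst_dualNumberMap {S S' : Type*} [CommRing S] [CommRing S'] (φ : S →+* S')
    (x : DualNumber S) : (dualNumberMap φ x).fst = φ x.fst := by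
  simp [dualNumberMap]

theorem snd_dualNumberMap {S S' : Type*} [CommRing S] [CommRing S'] (φ : S →+* S')
    (x : DualNumber S) : (dualNumberMap φ x).snd = φ x.snd := by
  simp [dualNumberMap]

/-- The value at `a` and the total derivative at `a` of a polynomial with coefficients that are
analytic at `a`. -/
noncomputable def jetEval (n : ℕ) (a : Fin m → ℂ) (j : Fin m) :
    MvPolynomial (Fin n) (RegularRing a) →+* DualNumber (MvPolynomial (JetVar n) ℂ) :=
  eval₂Hom ((dualNumberMap C).comp (dualEvalRegular a j))
    fun i => TrivSqZeroExt.inl (X (zVar i)) + TrivSqZeroExt.inr (X (dotVar i))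

theorem fst_jetEval (a : Fin m → ℂ) (j : Fin m) (F : MvPolynomial (Fin n) (RegularRing a)) :
    (jetEval n a j F).fst = incl (map (evalRegular a : RegularRing a →+* ℂ) F) := by
  induction F using MvPolynomial.induction_on with
  | C c =>
    simp [jetEval, fst_dualNumberMap, dualEvalRegular_apply, incl, evalRegular_apply]
  | add p q hp hq => simp [hp, hq]
  | mul_X p i hp => simp [hp]; simp [jetEval, incl]

theorem chainDeriv_add {k : Type*} [Field k] (p q : MvPolynomial (Fin n) k) :
    chainDeriv (p + q) = chainDeriv p + chainDeriv q := by
  simp [chainDeriv, add_mul, Finset.sum_add_distrib]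

theorem chainDeriv_C_mul {k : Type*} [Field k] (c : k) (p : MvPolynomial (Fin n) k) :
    chainDeriv (C c * p) = C c * chainDeriv p := by
  simp [chainDeriv, incl, Finset.mul_sum, mul_assoc]

theorem chainDeriv_mul_X {k : Type*} [Field k] (p : MvPolynomial (Fin n) k) (i : Fin n) :
    chainDeriv (p * X i) = chainDeriv p * X (zVar i) + incl p * X (dotVar i) := by
  classical
  have h : ∀ l, incl (pderiv l (p * X i)) * X (dotVar l) =
      incl (pderiv l p) * X (dotVar l) * X (zVar i) +
        (if l = i then incl p * X (dotVar i) else (0 : MvPolynomial (JetVar n) k)) := by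
    intro l
    rw [Derivation.leibniz, pderiv_X]
    by_cases h : l = i
    · subst h
      simp [incl]
      ring
    · simp [incl, h, Ne.symm h]
      ring
  simp only [chainDeriv, h, Finset.sum_add_distrib, Finset.sum_ite_eq', Finset.mem_univ, if_true,
    Finset.sum_mul]

/-- The derivative at `a` of the coefficients at fixed `z`. -/
noncomputable def paramDerivAt (a : Fin m → ℂ) (j : Fin m)
    (F : MvPolynomial (Fin n) (RegularRing a)) : MvPolynomial (Fin n) ℂ :=
  ∑ s ∈ F.support, monomial s (dualEvalRegular a j (coeff s F)).snd

theorem coeff_paramDerivAt (a : Fin m → ℂ) (j : Fin m) (F : MvPolynomial (Fin n) (RegularRing a))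
    (t : Fin n →₀ ℕ) : coeff t (paramDerivAt a j F) = (dualEvalRegular a j (coeff t F)).snd := by
  classical
  simp only [paramDerivAt, coeff_sum, coeff_monomial, Finset.sum_ite_eq', mem_support_iff]
  split_ifs with h
  · rfl
  · rw [not_not.mp h, map_zero, TrivSqZeroExt.snd_zero]

theorem paramDerivAt_monomial (a : Fin m → ℂ) (j : Fin m) (s : Fin n →₀ ℕ) (c : RegularRing a) :
    paramDerivAt a j (monomial s c) = monomial s (dualEvalRegular a j c).snd := by
  classical
  ext t
  rw [coeff_paramDerivAt, coeff_monomial, coeff_monomial]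
  split_ifs <;> simp

/-- Multiplication of dual numbers is the Leibniz rule, so the two summands come from the
coefficients and from the variables. -/
theorem snd_jetEval (a : Fin m → ℂ) (j : Fin m) (F : MvPolynomial (Fin n) (RegularRing a)) :
    (jetEval n a j F).snd =
      incl (paramDerivAt a j F) + chainDeriv (map (evalRegular a : RegularRing a →+* ℂ) F) := by
  classical
  induction F using MvPolynomial.induction_on with
  | C c =>
    rw [show paramDerivAt a j (C c : MvPolynomial (Fin n) (RegularRing a)) = _ from
      paramDerivAt_monomial a j 0 c]
    simp [jetEval, snd_dualNumberMap, incl, chainDeriv]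
  | add p q hp hq =>
    have h : paramDerivAt a j (p + q) = paramDerivAt a j p + paramDerivAt a j q := by
      ext t
      simp [coeff_paramDerivAt]
    rw [map_add, TrivSqZeroExt.snd_add, hp, hq, h, map_add, map_add, chainDeriv_add]
    ring
  | mul_X p i hp =>
    have h : paramDerivAt a j (p * X i) = paramDerivAt a j p * X i := by
      ext t
      rw [coeff_paramDerivAt, coeff_mul_X', coeff_mul_X', coeff_paramDerivAt]
      split_ifs <;> simp
    have hX : jetEval n a j (X i) =
        TrivSqZeroExt.inl (X (zVar i)) + TrivSqZeroExt.inr (X (dotVar i)) := by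
      simp [jetEval]
    have hincl : incl (X i : MvPolynomial (Fin n) ℂ) = X (zVar i) := by simp [incl]
    rw [map_mul, TrivSqZeroExt.snd_mul, hp, h, hX, fst_jetEval, map_mul, map_mul, map_X,
      chainDeriv_mul_X, hincl]
    simp only [TrivSqZeroExt.fst_add, TrivSqZeroExt.snd_add, TrivSqZeroExt.fst_inl,
      TrivSqZeroExt.fst_inr, TrivSqZeroExt.snd_inl, TrivSqZeroExt.snd_inr, add_zero, zero_add,
      smul_eq_mul, MulOpposite.smul_eq_mul_unop, MulOpposite.unop_op]
    ring

/-- This identifies the derivative generators of the jet ideal with the `ε`-parts of the images of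
the system. -/
theorem specialize_totalDeriv (a : Fin m → ℂ) (j : Fin m)
    (F : MvPolynomial (Fin n) (RegularRing a)) :
    specialize a (totalDeriv j (map (algebraMap (RegularRing a) (ParamField m)) F)) =
      (jetEval n a j F).snd := by
  obtain ⟨F', hF'⟩ := exists_map_eq_of_regularAt (a := a)
    (f := paramDeriv j (map (algebraMap (RegularRing a) (ParamField m)) F)) fun s => by
      rw [coeff_paramDeriv, coeff_map]
      exact regularAt_ratDeriv j (regularAt_iff_mem.mpr (coeff s F).2)
  have h1 : totalDeriv j (map (algebraMap (RegularRing a) (ParamField m)) F) =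
      map (algebraMap (RegularRing a) (ParamField m))
        (rename zVar F' + ∑ i, rename zVar (pderiv i F) * X (dotVar i)) := by
    simp [totalDeriv, ← hF', incl, chainDeriv, map_rename, pderiv_map]
  have h2 : map (evalRegular a : RegularRing a →+* ℂ) F' = paramDerivAt a j F := by
    ext t
    rw [coeff_paramDerivAt, dualEvalRegular_apply, ← specialize_map, hF', coeff_specialize,
      coeff_paramDeriv, coeff_map]
    simp
  rw [h1, specialize_map, snd_jetEval, ← h2]
  simp [incl, chainDeriv, map_rename, pderiv_map]

/-- If a multiple of `p` by a polynomial that specialises to `1` lies in the ideal of the system,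
then the value and the total derivative of `p` at `a` lie in the jet ideal. -/
theorem jetEval_mem_jetIdealAt (a : Fin m → ℂ) (j : Fin m)
    (F : Fin n → MvPolynomial (Fin n) (RegularRing a)) {g p : MvPolynomial (Fin n) (RegularRing a)}
    (hg : map (evalRegular a : RegularRing a →+* ℂ) g = 1)
    (hgp : g * p ∈ Ideal.span (Set.range F)) :
    (jetEval n a j p).fst ∈
        jetIdealAt (fun l => map (algebraMap (RegularRing a) (ParamField m)) (F l)) j a ∧
      (jetEval n a j p).snd ∈
        jetIdealAt (fun l => map (algebraMap (RegularRing a) (ParamField m)) (F l)) j a := by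
  set J := jetIdealAt (fun l => map (algebraMap (RegularRing a) (ParamField m)) (F l)) j a
  -- Reducing both components modulo `J` gives a ring homomorphism that kills the system.
  let Θ : MvPolynomial (Fin n) (RegularRing a) →+* DualNumber (MvPolynomial (JetVar n) ℂ ⧸ J) :=
    (dualNumberMap (Ideal.Quotient.mk J)).comp (jetEval n a j)
  have hfst : ∀ q, (Θ q).fst = Ideal.Quotient.mk J (jetEval n a j q).fst := fun q =>
    fst_dualNumberMap _ _
  have hsnd : ∀ q, (Θ q).snd = Ideal.Quotient.mk J (jetEval n a j q).snd := fun q =>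
    snd_dualNumberMap _ _
  have hF : ∀ l, Θ (F l) = 0 := by
    intro l
    ext
    · rw [hfst, TrivSqZeroExt.fst_zero, Ideal.Quotient.eq_zero_iff_mem, fst_jetEval,
        ← specialize_map]
      exact Ideal.mem_sup_left (Ideal.mem_map_of_mem _ (Ideal.subset_span ⟨l, rfl⟩))
    · rw [hsnd, TrivSqZeroExt.snd_zero, Ideal.Quotient.eq_zero_iff_mem, ← specialize_totalDeriv]
      exact Ideal.mem_sup_right (Ideal.subset_span ⟨l, rfl⟩)
  have hle : Ideal.span (Set.range F) ≤ RingHom.ker Θ := by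
    rw [Ideal.span_le]
    rintro _ ⟨l, rfl⟩
    exact hF l
  -- A dual number is a unit as soon as its value is; the derivative of `g` is irrelevant.
  have hunit : IsUnit (Θ g) := by
    rw [TrivSqZeroExt.isUnit_iff_isUnit_fst, hfst, fst_jetEval, hg, map_one, map_one]
    exact isUnit_one
  have h0 : Θ p = 0 := by
    have := RingHom.mem_ker.mp (hle hgp)
    rwa [map_mul, hunit.mul_right_eq_zero] at this
  rw [← Ideal.Quotient.eq_zero_iff_mem, ← Ideal.Quotient.eq_zero_iff_mem, ← hfst, ← hsnd, h0]
  exact ⟨rfl, rfl⟩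

end Jets

/-! ### The companion relations and the main theorem -/

variable {m n d : ℕ}

theorem paramDerivAt_X_mul_monomial_one (a : Fin m → ℂ) (j : Fin m) (i : Fin n) (s : Fin n →₀ ℕ) :
    paramDerivAt a j (X i * monomial s 1) = 0 := by
  rw [X, monomial_mul, paramDerivAt_monomial]
  simp

theorem chainDeriv_monomial (s : Fin n →₀ ℕ) (c : ℂ) :
    chainDeriv (monomial s c) = C c * chainDeriv (monomial s 1) := by
  rw [← chainDeriv_C_mul, C_mul_monomial, mul_one]

theorem fst_jetEval_X_mul_sub (a : Fin m → ℂ) (j : Fin m) (i : Fin n) (e : Fin d → Fin n →₀ ℕ)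
    (α : Fin d) (t : Fin d → RegularRing a) :
    (jetEval n a j (X i * monomial (e α) 1 - monomialComb e t)).fst =
      incl (X i * monomial (e α) 1) - ∑ β, incl (monomial (e β) (evalAt a (t β))) := by
  rw [fst_jetEval, map_sub, map_sub, map_monomialComb, monomialComb_apply, map_sum]
  simp only [map_mul, map_X, map_monomial, map_one]
  simp only [RingHom.coe_coe, evalRegular_apply]

theorem snd_jetEval_X_mul_sub (a : Fin m → ℂ) (j : Fin m) (i : Fin n) (e : Fin d → Fin n →₀ ℕ)
    (α : Fin d) (t : Fin d → RegularRing a) :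
    (jetEval n a j (X i * monomial (e α) 1 - monomialComb e t)).snd =
      chainDeriv (X i * monomial (e α) 1) -
        ∑ β, C (evalAt a (t β)) * chainDeriv (monomial (e β) 1) -
        ∑ β, incl (monomial (e β) (evalAt a (ratDeriv j (t β)))) := by
  have h : ∀ β, (jetEval n a j (monomial (e β) (t β))).snd =
      C (evalAt a (t β)) * chainDeriv (monomial (e β) 1) +
        incl (monomial (e β) (evalAt a (ratDeriv j (t β)))) := by
    intro β
    rw [snd_jetEval, paramDerivAt_monomial, map_monomial, chainDeriv_monomial, add_comm,
      dualEvalRegular_apply]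
    simp [evalRegular_apply]
  have hsum : (jetEval n a j (monomialComb e t)).snd =
      ∑ β, (jetEval n a j (monomial (e β) (t β))).snd := by
    rw [monomialComb_apply, map_sum]
    exact map_sum (TrivSqZeroExt.sndHom (MvPolynomial (JetVar n) ℂ) (MvPolynomial (JetVar n) ℂ)) _ _
  rw [map_sub, TrivSqZeroExt.snd_sub, hsum, snd_jetEval, paramDerivAt_X_mul_monomial_one]
  simp only [h, Finset.sum_add_distrib, map_zero, zero_add, map_mul, map_X, map_monomial, map_one]
  ring

theorem mem_image_of_mem_support_sum_incl {e : Fin d → Fin n →₀ ℕ} {c : Fin d → ℂ}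
    {s : JetVar n →₀ ℕ} (hs : s ∈ (∑ β, incl (monomial (e β) (c β))).support) :
    s ∈ Finsupp.mapDomain zVar '' Set.range e := by
  classical
  obtain ⟨β, -, hβ⟩ := Finset.mem_biUnion.mp (support_sum hs)
  rw [incl, rename_monomial] at hβ
  exact ⟨e β, ⟨β, rfl⟩, (Finset.mem_singleton.mp (support_monomial_subset hβ)).symm⟩

end CompanionDeriv

theorem mainTheorem4 {m n d : ℕ}
    (f : Fin n → MvPolynomial (Fin n) (ParamField m))
    -- a lexicographic Gröbner basis of the ideal over the field of rational functions,
    -- and an enumeration of its standard monomials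
    (G : Finset (MvPolynomial (Fin n) (ParamField m)))
    (hG : IsGroebnerBasis MonomialOrder.lex G (genericIdeal f))
    (e : Fin d → Fin n →₀ ℕ) (he : Function.Injective e)
    (he_range : Set.range e = standardMonomials MonomialOrder.lex G)
    -- a generic point at which the companion matrices can be evaluated
    (a : Fin m → ℂ) (ha : IsGenericParam f a)
    (hT : ∀ i α β, RegularAt a (companionMatrix MonomialOrder.lex G e i α β))
    (j : Fin m)
    (Ga : Finset (MvPolynomial (Fin n) ℂ))
    (hGa : IsGroebnerBasis MonomialOrder.lex Ga (idealAt f a))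
    (Gj : Finset (MvPolynomial (JetVar n) ℂ))
    (hGj : IsGroebnerBasis MonomialOrder.lex Gj (jetIdealAt f j a))
    -- the standard basis is unchanged
    (hB : standardMonomials MonomialOrder.lex Gj =
      Finsupp.mapDomain zVar '' standardMonomials MonomialOrder.lex Ga) :
    -- the values at `a` are the companion matrices of `I(a)` in its standard basis
    (standardMonomials MonomialOrder.lex Ga = Set.range e ∧
      ∀ i, companionMatrix MonomialOrder.lex Ga e i =
        (companionMatrix MonomialOrder.lex G e i).map (evalAt a)) ∧
    -- they are computed by reduction modulo `Gj`
    (∀ i α, normalForm MonomialOrder.lex Gj (incl (X i * monomial (e α) 1)) =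
      ∑ β, incl (monomial (e β)
        (evalAt a (companionMatrix MonomialOrder.lex G e i α β)))) ∧
    -- and so are their partial derivatives
    (∀ i α, normalForm MonomialOrder.lex Gj
        (chainDeriv (X i * monomial (e α) 1) -
          ∑ β, C (evalAt a (companionMatrix MonomialOrder.lex G e i α β)) *
            chainDeriv (monomial (e β) 1)) =
      ∑ β, incl (monomial (e β)
        (evalAt a (ratDeriv j (companionMatrix MonomialOrder.lex G e i α β))))) := by
  choose F hF using fun l => exists_map_eq_of_regularAt (a := a) (f := f l) (ha.regular l)
  obtain rfl : (fun l => map (algebraMap (RegularRing a) (ParamField m)) (F l)) = f := funext hF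
  have hidealAt : idealAt (fun l => map (algebraMap (RegularRing a) (ParamField m)) (F l)) a =
      Ideal.span (Set.range fun l => map (evalRegular a : RegularRing a →+* ℂ) (F l)) := by
    simp only [idealAt, specialize_map]
  have hfin := ha.finite_zeros
  have hrad := ha.isRadical
  rw [hidealAt] at hfin hrad hGa
  let T : Fin n → Matrix (Fin d) (Fin d) (RegularRing a) := fun i => Matrix.of fun α β =>
    ⟨companionMatrix MonomialOrder.lex G e i α β, regularAt_iff_mem.mp (hT i α β)⟩
  have hTG : ∀ i α β, algebraMap (RegularRing a) (ParamField m) (T i α β) =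
      companionMatrix MonomialOrder.lex G e i α β := fun _ _ _ => rfl
  have hspec : ∀ p ∈ integralIdeal (ParamField m) F,
      map (evalRegular a : RegularRing a →+* ℂ) p ∈
        Ideal.span (Set.range fun l => map (evalRegular a : RegularRing a →+* ℂ) (F l)) :=
    fun p hp => map_mem_span_of_mem_integralIdeal _ F hfin hrad hp
  have hstd : standardMonomials MonomialOrder.lex Ga = Set.range e :=
    standardMonomials_specialization hG he he_range hTG hspec hGa
  obtain ⟨g, hg, hgP⟩ :=
    exists_mul_mem_span_of_integralIdeal_specializes hG he he_range hTG hspec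
  have hP := X_mul_monomial_sub_mem_integralIdeal hG he he_range hTG
  -- Value and derivative of each companion relation lie in the jet ideal; these are the two
  -- reduction formulas up to standardness of the right-hand sides.
  have hjet := fun i α => jetEval_mem_jetIdealAt a j F hg (hgP _ (hP i α))
  simp only [fst_jetEval_X_mul_sub, snd_jetEval_X_mul_sub] at hjet
  refine ⟨⟨hstd, fun i => ?_⟩, fun i α => ?_, fun i α => ?_⟩
  · ext α β
    have hmem := hspec _ (hP i α)
    rw [map_sub, map_monomialComb, map_mul, map_X, map_monomial, map_one] at hmem
    have hnf := hGa.normalForm_eq_of_sub_mem hmem fun s hs => by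
      obtain ⟨β, rfl, -⟩ := exists_of_mem_support_monomialComb hs
      exact hstd ▸ ⟨β, rfl⟩
    rw [companionMatrix, Matrix.of_apply, hnf, coeff_monomialComb he, Matrix.map_apply]
    exact evalRegular_apply a _
  · refine hGj.normalForm_eq_of_sub_mem (hjet i α).1 fun s hs => ?_
    -- The right-hand side involves only the `e β`, which are standard for `Gj` because the standard
    -- bases coincide.
    rw [hB, hstd]
    exact mem_image_of_mem_support_sum_incl hs
  · refine hGj.normalForm_eq_of_sub_mem (hjet i α).2 fun s hs => ?_
    rw [hB, hstd]
    exact mem_image_of_mem_support_sum_incl hs
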